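/- Let $\alpha=(1+\sqrt5)/2$ be the golden ratio. For a binary word $y$ let $\overline{y}$ denote the word obtained by exchanging the letters $0$ and $1$; an antisquare is a nonempty finite word of the form $y\,\overline{y}$. Call a (right-infinite or bi-infinite) binary word good if none of its finite factors is an antisquare, except possibly $01$ and $10$. The exponent of a nonempty finite word $u=u_1\cdots u_n$ is $n/p$, where $p\ge 1$ is the smallest period of $u$, that is, the least integer $p\geq 1$ such that $u_i=u_{i+p}$ for $1\le i\le n-p$. The critical exponent of an infinite word is the supremum (possibly $+\infty$) of the exponents of its nonempty finite factors, and the repetition threshold of a set $L$ of right-infinite words is the infimum of the critical exponents of the elements of $L$. Then: (i) every good bi-infinite binary word has critical exponent at least $2+\alpha$; (ii) every good right-infinite binary word has critical exponent at least $2+\alpha$; (iii) the repetition threshold of the set of good right-infinite binary words is exactly $2+\alpha$. -/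

import Mathlib

/-- The complement of a binary word (`false` is the letter 0, `true` is the letter 1). -/
def complementWord (y : List Bool) : List Bool := y.map not

/-- A nonempty binary word of the form `y` followed by the complement of `y`. -/
def IsAntisquare (x : List Bool) : Prop :=
  x ≠ [] ∧ ∃ y : List Bool, x = y ++ complementWord y

/-- The smallest period `p ≥ 1` of a word (for a nonempty word, its length is a period). -/
noncomputable def wordPeriod (u : List Bool) : ℕ := sInf {p | 1 ≤ p ∧ u.HasPeriod p}

/-- The exponent of a finite word: length divided by smallest period. -/
noncomputable def wordExponent (u : List Bool) : ℝ := (u.length : ℝ) / (wordPeriod u : ℝ)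

/-- The set of finite factors of a right-infinite binary word. -/
def rightFactors (w : ℕ → Bool) : Set (List Bool) :=
  {u | ∃ i n : ℕ, u = (List.range n).map fun k => w (i + k)}

/-- The set of finite factors of a bi-infinite binary word. -/
def biFactors (w : ℤ → Bool) : Set (List Bool) :=
  {u | ∃ (i : ℤ) (n : ℕ), u = (List.range n).map fun k : ℕ => w (i + k)}

/-- A word with set of factors `F` is good if it contains no antisquares except possibly
01 and 10. -/
def GoodFactors (F : Set (List Bool)) : Prop :=
  ∀ u ∈ F, IsAntisquare u → u = [false, true] ∨ u = [true, false]

/-- The critical exponent of a word with set of factors `F`: the supremum, possibly infinite,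
of the exponents of its nonempty factors. -/
noncomputable def criticalExponent (F : Set (List Bool)) : EReal :=
  ⨆ u ∈ {u | u ∈ F ∧ u ≠ []}, (wordExponent u : EReal)

/-- The repetition threshold of a language of right-infinite binary words: the infimum of the
critical exponents of its elements. -/
noncomputable def repetitionThreshold (L : Set (ℕ → Bool)) : EReal :=
  ⨅ w ∈ L, criticalExponent (rightFactors w)

/-!
The lower bound is a desubstitution argument. In a good word all of whose repetitions have exponent
at most `c < 2 + φ`, the short antisquares and the fourth powers of letters are excluded, and this
forces a suffix of the word or of its complement to be a product of the blocks `A = 0001` and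
`B = 01` (`LocallyGood.hasLevel_zero`). Neither `BB` nor `AAA` can occur in this product, hence it
is a product of the blocks `AAB` and `AB`. The same two exclusions hold for these, because
all long products of blocks of one level share a prefix of `|B| - 1` and a suffix of `|A| - 2`
letters, by which each repetition of blocks extends; so the process never stops
(`HasLevel.succ`). At every level a square `AA` of long blocks appears. With the common extensions
its exponent is `(3|A| + |B| - 3) / |A|`, which tends to `2 + φ` since `|A| / |B|` tends to `φ`
(`not_hasLevel_zero`). A bi-infinite word has all factors of its right half.

For the upper bound, let `s` be the fixed point of `A ↦ AAB`, `B ↦ AB` (it has the factors of the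
Fibonacci word) and `w` its image under `A ↦ 0001`, `B ↦ 01`. That `w` is good can be seen from
the letters around the centre of an antisquare (`noLongAntisquare_code`). A repetition of `w` or `s` with large
exponent is, up to a few letters at its ends, the image of a repetition of `s` with a smaller
period. The letters lost at the ends of all levels add up to the same `|A| + |B| - 3` as above, and
the descent ends with a repetition of period `A`, that is with `AA`, or of exponent at most two;
this gives the bound `2 + φ` for all exponents (`IsImage.prefixWeight_lt`).
-/

/-! ### Repetitions and exponents -/

/-- The word `w` has period `q` on the positions in `[i, j)`. -/
def PeriodicOn (w : ℕ → Bool) (q i j : ℕ) : Prop :=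
  ∀ k, i ≤ k → k + q < j → w k = w (k + q)

theorem hasPeriod_factor_iff (w : ℕ → Bool) (i n p : ℕ) :
    ((List.range n).map fun k => w (i + k)).HasPeriod p ↔ PeriodicOn w p i (i + n) := by
  rw [List.hasPeriod_iff_getElem?]
  simp only [List.length_map, List.length_range, List.getElem?_map]
  constructor
  · intro h k hk hkn
    have := h (k - i) (by omega)
    rw [List.getElem?_range (by omega), List.getElem?_range (by omega)] at this
    simp only [Option.map_some, Option.some.injEq] at this
    rwa [show i + (k - i) = k by omega, show i + (k - i + p) = k + p by omega] at this
  · intro h k hk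
    rw [List.getElem?_range (by omega), List.getElem?_range (by omega)]
    simp only [Option.map_some, Option.some.injEq]
    rw [← Nat.add_assoc]
    exact h (i + k) (by omega) (by omega)

theorem wordPeriod_spec {u : List Bool} (hu : u ≠ []) :
    1 ≤ wordPeriod u ∧ u.HasPeriod (wordPeriod u) ∧ wordPeriod u ≤ u.length := by
  have hmem : u.length ∈ {p | 1 ≤ p ∧ u.HasPeriod p} :=
    ⟨List.length_pos_iff.2 hu, List.hasPeriod_of_length_le _ _ le_rfl⟩
  exact ⟨(Nat.sInf_mem ⟨_, hmem⟩).1, (Nat.sInf_mem ⟨_, hmem⟩).2, Nat.sInf_le hmem⟩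

theorem PeriodicOn.le_criticalExponent {w : ℕ → Bool} {d i L : ℕ} (hd : 1 ≤ d) (hL : 1 ≤ L)
    (h : PeriodicOn w d i (i + L)) :
    (((L : ℝ) / d : ℝ) : EReal) ≤ criticalExponent (rightFactors w) := by
  set u := (List.range L).map fun k => w (i + k) with hu
  have hlen : u.length = L := by simp [hu]
  have hne : u ≠ [] := by rw [← List.length_pos_iff]; omega
  have hp : wordPeriod u ≤ d := Nat.sInf_le ⟨hd, (hasPeriod_factor_iff w i L d).2 h⟩
  have h1 : 1 ≤ wordPeriod u := (wordPeriod_spec hne).1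
  have h2 : (L : ℝ) / d ≤ wordExponent u := by
    rw [wordExponent, hlen]
    have : (0 : ℝ) < wordPeriod u := by exact_mod_cast h1
    gcongr
  refine (EReal.coe_le_coe_iff.2 h2).trans ?_
  exact le_iSup₂ (f := fun (u : List Bool) (_ : u ∈ {u | u ∈ rightFactors w ∧ u ≠ []}) =>
    (wordExponent u : EReal)) u ⟨⟨i, L, rfl⟩, hne⟩

theorem criticalExponent_le {w : ℕ → Bool} {c : ℝ}
    (h : ∀ q i j, 1 ≤ q → i + q ≤ j → PeriodicOn w q i j → ((j : ℝ) - i) ≤ c * q) :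
    criticalExponent (rightFactors w) ≤ (c : EReal) := by
  refine iSup₂_le ?_
  rintro u ⟨⟨i, n, rfl⟩, hne⟩
  obtain ⟨h1, h2, h3⟩ := wordPeriod_spec hne
  rw [EReal.coe_le_coe_iff, wordExponent]
  set p := wordPeriod ((List.range n).map fun k => w (i + k))
  simp only [List.length_map, List.length_range] at h3 ⊢
  have hp : (0 : ℝ) < p := by exact_mod_cast h1
  rw [div_le_iff₀ hp]
  have := h p i (i + n) h1 (by omega) ((hasPeriod_factor_iff w i n p).1 h2)
  push_cast at this
  linarith

/-! ### Goodness in terms of positions -/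

/-- No factor of `w` is an antisquare of length at least four. -/
def NoLongAntisquare (w : ℕ → Bool) : Prop :=
  ∀ i n, 2 ≤ n → ∃ j < n, w (i + j) = w (i + n + j)

theorem goodFactors_iff (w : ℕ → Bool) :
    GoodFactors (rightFactors w) ↔ NoLongAntisquare w := by
  constructor
  · intro h i n hn
    by_contra! hc
    have hanti : IsAntisquare ((List.range (n + n)).map fun k => w (i + k)) := by
      refine ⟨by simp; omega, (List.range n).map fun k => w (i + k), ?_⟩
      rw [List.range_add, List.map_append, complementWord, List.map_map, List.map_map]
      congr 1
      refine List.map_congr_left fun k hk => ?_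
      have := hc k (List.mem_range.1 hk)
      rw [Nat.add_assoc] at this
      simpa [Function.comp, Bool.eq_not, eq_comm] using this
    have := h _ ⟨i, n + n, rfl⟩ hanti
    have hlen : ((List.range (n + n)).map fun k => w (i + k)).length = 2 := by
      rcases this with h | h <;> rw [h] <;> rfl
    simp at hlen
    omega
  · rintro h u ⟨i, m, rfl⟩ ⟨hne, y, hy⟩
    have hlen := congrArg List.length hy
    simp only [complementWord, List.length_map, List.length_range, List.length_append] at hlen
    rcases Nat.lt_or_ge y.length 2 with hy2 | hy2
    · match y, hy2 with
      | [], _ => simp [complementWord] at hy; simp [hy] at hne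
      | [a], _ => rw [hy]; cases a <;> simp [complementWord]
      | _ :: _ :: _, h => simp at h
    · obtain ⟨j, hj, hwj⟩ := h i y.length hy2
      exfalso
      have e1 := congrArg (fun l => l[j]?) hy
      have e2 := congrArg (fun l => l[y.length + j]?) hy
      simp only [complementWord] at e1 e2
      rw [List.getElem?_map, List.getElem?_range (by omega),
        List.getElem?_append_left hj] at e1
      rw [List.getElem?_map, List.getElem?_range (by omega),
        List.getElem?_append_right (by omega), Nat.add_sub_cancel_left, List.getElem?_map,
        ← e1] at e2
      simp [← Nat.add_assoc, hwj] at e2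

/-! ### Block lengths -/

/-- The lengths of the two blocks of each level: `(4, 2)` at level `0`, and a block of the next
level is the product of two long blocks and a short one, or of a long one and a short one. -/
def blockLength : ℕ → Bool → ℕ
  | 0, false => 4
  | 0, true => 2
  | n + 1, false => 2 * blockLength n false + blockLength n true
  | n + 1, true => blockLength n false + blockLength n true

theorem blockLength_bounds (n : ℕ) : n + 4 ≤ blockLength n false ∧ n + 2 ≤ blockLength n true := by
  induction n with
  | zero => simp [blockLength]
  | succ n ih => simp only [blockLength]; omega

theorem goldenRatio_mul_self : Real.goldenRatio * Real.goldenRatio = Real.goldenRatio + 1 := by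
  rw [← sq, Real.goldenRatio_sq]

/-- The lengths are nearly in golden ratio: the defect `a - φ b` is multiplied by
`2 - φ ∈ (0, 1)` from one level to the next. -/
theorem blockLength_golden (n : ℕ) :
    0 ≤ (blockLength n false : ℝ) - Real.goldenRatio * blockLength n true ∧
      (blockLength n false : ℝ) - Real.goldenRatio * blockLength n true ≤ 1 := by
  have h1 := Real.goldenRatio_lt_two
  have h2 := Real.one_lt_goldenRatio
  have h3 := goldenRatio_mul_self
  induction n with
  | zero =>
    simp only [blockLength]
    push_cast
    constructor <;> nlinarith
  | succ n ih =>
    have key : (blockLength (n + 1) false : ℝ) - Real.goldenRatio * blockLength (n + 1) true =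
        (2 - Real.goldenRatio) *
          ((blockLength n false : ℝ) - Real.goldenRatio * blockLength n true) := by
      simp only [blockLength]
      push_cast
      linear_combination -(blockLength n true : ℝ) * h3
    rw [key]
    obtain ⟨i1, i2⟩ := ih
    constructor
    · exact mul_nonneg (by linarith) i1
    · nlinarith

/-! ### Occurrences of finite words -/

/-- The finite word `u` occurs in `w` at position `p`. -/
def OccursAt (w : ℕ → Bool) (p : ℕ) (u : List Bool) : Prop :=
  ∀ j (hj : j < u.length), w (p + j) = u[j]

theorem occursAt_append {w : ℕ → Bool} {p : ℕ} {u v : List Bool} :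
    OccursAt w p (u ++ v) ↔ OccursAt w p u ∧ OccursAt w (p + u.length) v := by
  constructor
  · intro h
    refine ⟨fun j hj => ?_, fun j hj => ?_⟩
    · rw [h j (by simp; omega), List.getElem_append_left]
    · rw [Nat.add_assoc, h (u.length + j) (by simp; omega), List.getElem_append_right (by omega)]
      simp
  · rintro ⟨h1, h2⟩ j hj
    rcases Nat.lt_or_ge j u.length with hju | hju
    · rw [h1 j hju, List.getElem_append_left]
    · have := h2 (j - u.length) (by simp at hj; omega)
      rw [show p + u.length + (j - u.length) = p + j by omega] at this
      rw [this, List.getElem_append_right hju]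

theorem OccursAt.periodicOn {w : ℕ → Bool} {p d : ℕ} {u : List Bool} (h1 : OccursAt w p u)
    (h2 : OccursAt w (p + d) u) : PeriodicOn w d p (p + (d + u.length)) := by
  intro k hk hk2
  have e1 := h1 (k - p) (by omega)
  have e2 := h2 (k - p) (by omega)
  rw [show p + (k - p) = k by omega] at e1
  rw [show p + d + (k - p) = k + d by omega] at e2
  rw [e1, e2]

/-! ### The lower bound: desubstitution -/

/-- The two blocks of each level: `0001` and `01` at level `0`, and then the images of the
previous ones under `A ↦ AAB`, `B ↦ AB`; the letter `false` stands for `A`, `true` for `B`. -/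
def block : ℕ → Bool → List Bool
  | 0, false => [false, false, false, true]
  | 0, true => [false, true]
  | n + 1, false => block n false ++ block n false ++ block n true
  | n + 1, true => block n false ++ block n true

/-- A word with which every product of sufficiently many blocks of level `n` begins. -/
def rightContext : ℕ → List Bool
  | 0 => [false]
  | n + 1 => block n false ++ rightContext n

/-- A word with which every product of sufficiently many blocks of level `n` ends. -/
def leftContext : ℕ → List Bool
  | 0 => [false, true]
  | n + 1 => leftContext n ++ block n false ++ block n true

theorem length_block (n : ℕ) (b : Bool) : (block n b).length = blockLength n b := by
  induction n generalizing b with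
  | zero => cases b <;> rfl
  | succ n ih => cases b <;> simp [block, blockLength, ih]; omega

theorem length_rightContext (n : ℕ) : (rightContext n).length + 1 = blockLength n true := by
  induction n with
  | zero => rfl
  | succ n ih => simp [rightContext, blockLength, length_block]; omega

theorem length_leftContext (n : ℕ) : (leftContext n).length + 2 = blockLength n false := by
  induction n with
  | zero => rfl
  | succ n ih => simp [leftContext, blockLength, length_block]; omega

/-- `P` is a set of positions at which `w` can be cut into blocks of level `n`: at each of them a
block begins that ends at another one, and the contexts common to all blocks are present. -/
def IsCutSet (w : ℕ → Bool) (n : ℕ) (P : Set ℕ) : Prop :=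
  ∀ p ∈ P, (∃ q, q + (leftContext n).length = p ∧ OccursAt w q (leftContext n)) ∧
    OccursAt w p (rightContext n) ∧
    ∃ b, OccursAt w p (block n b) ∧ p + blockLength n b ∈ P

/-- All repetitions in `w` have exponent at most `c`. -/
def ExponentsLE (w : ℕ → Bool) (c : ℝ) : Prop :=
  ∀ d i L, 1 ≤ d → PeriodicOn w d i (i + L) → (L : ℝ) ≤ c * d

/-- If the product `u` of some blocks begins at two cuts at distance `d`, then the part of `w` from
the left context of the first occurrence to the right context of the second has period `d`. -/
theorem IsCutSet.repetition {w : ℕ → Bool} {n : ℕ} {P : Set ℕ} (hP : IsCutSet w n P) {c : ℝ}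
    (hc : ExponentsLE w c) {p d : ℕ} (u : List Bool) (hd : 1 ≤ d) (h1 : p ∈ P) (h2 : p + d ∈ P)
    (h3 : p + u.length ∈ P) (h4 : p + d + u.length ∈ P) (h5 : OccursAt w p u)
    (h6 : OccursAt w (p + d) u) :
    (d : ℝ) + u.length + blockLength n false + blockLength n true - 3 ≤ c * d := by
  obtain ⟨⟨q, hq, hql⟩, -, -⟩ := hP p h1
  obtain ⟨⟨q', hq', hql'⟩, -, -⟩ := hP _ h2
  obtain rfl : q' = q + d := by omega
  obtain ⟨-, hr, -⟩ := hP _ h3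
  obtain ⟨-, hr', -⟩ := hP _ h4
  have o1 : OccursAt w q (leftContext n ++ (u ++ rightContext n)) := by
    rw [occursAt_append, occursAt_append, hq]
    exact ⟨hql, h5, hr⟩
  have o2 : OccursAt w (q + d) (leftContext n ++ (u ++ rightContext n)) := by
    rw [occursAt_append, occursAt_append, hq']
    exact ⟨hql', h6, hr'⟩
  have := hc _ _ _ hd (o1.periodicOn o2)
  have e1 : ((rightContext n).length : ℝ) + 1 = blockLength n true := by
    exact_mod_cast length_rightContext n
  have e2 : ((leftContext n).length : ℝ) + 2 = blockLength n false := by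
    exact_mod_cast length_leftContext n
  simp only [List.length_append] at this
  push_cast at this
  linarith

theorem IsCutSet.not_long_cube {w : ℕ → Bool} {n : ℕ} {P : Set ℕ} (hP : IsCutSet w n P) {c : ℝ}
    (hc : ExponentsLE w c) (hlt : c < 2 + Real.goldenRatio) {p : ℕ} (h0 : p ∈ P)
    (h1 : p + blockLength n false ∈ P)
    (h2 : p + blockLength n false + blockLength n false ∈ P)
    (h3 : p + blockLength n false + blockLength n false + blockLength n false ∈ P)
    (o0 : OccursAt w p (block n false)) (o1 : OccursAt w (p + blockLength n false) (block n false))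
    (o2 : OccursAt w (p + blockLength n false + blockLength n false) (block n false)) :
    False := by
  obtain ⟨b1, b2⟩ := blockLength_bounds n
  have := hP.repetition hc (block n false ++ block n false) (d := blockLength n false) (by omega)
    h0 h1 (by simpa [length_block, ← Nat.add_assoc] using h2)
    (by simpa [length_block, ← Nat.add_assoc] using h3)
    (by rw [occursAt_append, length_block]; exact ⟨o0, o1⟩)
    (by rw [occursAt_append, length_block]; exact ⟨o1, o2⟩)
  simp only [List.length_append, length_block] at this
  push_cast at this
  have g := Real.goldenRatio_lt_two
  have b1' : (n : ℝ) + 4 ≤ blockLength n false := by exact_mod_cast b1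
  have b2' : (n : ℝ) + 2 ≤ blockLength n true := by exact_mod_cast b2
  have hn : (0 : ℝ) ≤ n := n.cast_nonneg
  obtain ⟨g1, g2⟩ := blockLength_golden n
  have := Real.one_lt_goldenRatio
  have hg3 := goldenRatio_mul_self
  have hg4 : Real.goldenRatio < 1.7 := by nlinarith
  nlinarith

/-- Two consecutive short blocks at a level above `0` give a repetition of exponent at least
`2 + φ`. At level `0` the contexts are too short, and goodness has to be used instead. -/
theorem IsCutSet.not_short_square {w : ℕ → Bool} {n : ℕ} {P : Set ℕ}
    (hP : IsCutSet w (n + 1) P) {c : ℝ} (hc : ExponentsLE w c)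
    (hlt : c < 2 + Real.goldenRatio) {p : ℕ} (h0 : p ∈ P)
    (h1 : p + blockLength (n + 1) true ∈ P)
    (h2 : p + blockLength (n + 1) true + blockLength (n + 1) true ∈ P)
    (o0 : OccursAt w p (block (n + 1) true))
    (o1 : OccursAt w (p + blockLength (n + 1) true) (block (n + 1) true)) : False := by
  obtain ⟨b1, b2⟩ := blockLength_bounds (n + 1)
  have := hP.repetition hc (block (n + 1) true) (d := blockLength (n + 1) true) (by omega)
    h0 h1 (by simpa [length_block] using h1) (by simpa [length_block] using h2) o0 o1
  rw [length_block] at this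
  have b2' : ((n + 1 : ℕ) : ℝ) + 2 ≤ blockLength (n + 1) true := by exact_mod_cast b2
  push_cast at b2'
  have hn : (0 : ℝ) ≤ n := n.cast_nonneg
  obtain ⟨g1, g2⟩ := blockLength_golden (n + 1)
  nlinarith

/-- The decomposition into blocks of level `n` with no two consecutive short blocks. -/
def HasLevel (w : ℕ → Bool) (n : ℕ) : Prop :=
  ∃ P : Set ℕ, P.Nonempty ∧ IsCutSet w n P ∧
    ∀ p ∈ P, p + blockLength n true ∈ P → p + blockLength n true + blockLength n true ∈ P →
      OccursAt w p (block n true) → OccursAt w (p + blockLength n true) (block n true) → False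

/-- Desubstitution: cutting after each short block of level `n` gives the blocks of level
`n + 1`. -/
theorem HasLevel.succ {w : ℕ → Bool} {n : ℕ} (h : HasLevel w n) {c : ℝ}
    (hc : ExponentsLE w c) (hlt : c < 2 + Real.goldenRatio) : HasLevel w (n + 1) := by
  obtain ⟨P, ⟨p₀, hp₀⟩, hP, hBB⟩ := h
  set a := blockLength n false with ha
  set b := blockLength n true with hb
  let Q : Set ℕ := {p | ∃ q ∈ P, q + a ∈ P ∧ q + a + b = p ∧ p ∈ P ∧
    OccursAt w q (block n false) ∧ OccursAt w (q + a) (block n true)}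
  have hAAA := fun p => hP.not_long_cube hc hlt (p := p)
  have hlong : ∀ p ∈ P, ∃ r ∈ Q, p + a < r := by
    -- From any cut, a long block followed by a short one is reached within four blocks.
    have hA : ∀ p ∈ P, OccursAt w p (block n false) → p + a ∈ P → ∃ r ∈ Q, p + a < r := by
      intro p hp o h1
      have hbpos := (blockLength_bounds n).2
      obtain ⟨-, -, x, ox, hx⟩ := hP _ h1
      cases x with
      | true => exact ⟨_, ⟨p, hp, h1, rfl, hx, o, ox⟩, by omega⟩
      | false =>
        obtain ⟨-, -, y, oy, hy⟩ := hP _ hx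
        cases y with
        | true => exact ⟨_, ⟨_, h1, hx, rfl, hy, ox, oy⟩, by omega⟩
        | false => exact (hAAA p hp h1 hx hy o ox oy).elim
    intro p hp
    obtain ⟨-, -, x, ox, hx⟩ := hP p hp
    cases x with
    | false => exact hA p hp ox hx
    | true =>
      obtain ⟨-, -, y, oy, hy⟩ := hP _ hx
      cases y with
      | true => exact (hBB p hp hx hy ox oy).elim
      | false =>
        obtain ⟨r, hr, hlt⟩ := hA _ hx oy hy
        exact ⟨r, hr, by omega⟩
  have hQ : IsCutSet w (n + 1) Q := by
    rintro p ⟨q, hq, hqa, hqp, hp, oA, oB⟩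
    obtain ⟨-, -, x, ox, hx⟩ := hP p hp
    cases x with
    | true =>
      subst hqp
      exact (hBB _ hqa hp hx oB ox).elim
    | false =>
      refine ⟨?_, ?_, ?_⟩
      · obtain ⟨⟨r, hr, or⟩, -, -⟩ := hP q hq
        refine ⟨r, ?_, ?_⟩
        · simp only [leftContext, List.length_append, length_block]
          omega
        · simp only [leftContext]
          rw [occursAt_append, occursAt_append, List.length_append, length_block,
            ← Nat.add_assoc, hr]
          exact ⟨⟨or, oA⟩, oB⟩
      · simp only [rightContext]
        rw [occursAt_append, length_block]
        exact ⟨ox, (hP _ hx).2.1⟩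
      · obtain ⟨-, -, y, oy, hy⟩ := hP _ hx
        cases y with
        | true =>
          refine ⟨true, ?_, p, hp, hx, ?_, ?_, ox, oy⟩
          · simp only [block]
            rw [occursAt_append, length_block]
            exact ⟨ox, oy⟩
          · simp only [blockLength]; omega
          · simp only [blockLength]
            rwa [← Nat.add_assoc]
        | false =>
          obtain ⟨-, -, z, oz, hz⟩ := hP _ hy
          cases z with
          | false => exact (hAAA p hp hx hy hz ox oy oz).elim
          | true =>
            refine ⟨false, ?_, _, hx, hy, ?_, ?_, oy, oz⟩
            · simp only [block]
              rw [occursAt_append, occursAt_append, List.length_append, length_block,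
                ← Nat.add_assoc]
              exact ⟨⟨ox, oy⟩, oz⟩
            · simp only [blockLength]; omega
            · simp only [blockLength]
              rwa [two_mul, ← Nat.add_assoc, ← Nat.add_assoc]
  obtain ⟨r, hr, -⟩ := hlong p₀ hp₀
  exact ⟨Q, ⟨r, hr⟩, hQ, fun p h0 h1 h2 o0 o1 => hQ.not_short_square hc hlt h0 h1 h2 o0 o1⟩

/-- A word with decompositions at all levels contains the square of a long block at each level,
and with the contexts its exponent tends to `2 + φ`. -/
theorem not_hasLevel_zero {w : ℕ → Bool} {c : ℝ} (hc : ExponentsLE w c)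
    (hlt : c < 2 + Real.goldenRatio) : ¬ HasLevel w 0 := by
  intro h0
  have hall : ∀ n, HasLevel w n := fun n => by
    induction n with
    | zero => exact h0
    | succ n ih => exact ih.succ hc hlt
  have hsq : ∀ n, 3 * (blockLength n false : ℝ) + blockLength n true - 3 ≤
      c * blockLength n false := by
    intro n
    obtain ⟨b1, b2⟩ := blockLength_bounds n
    obtain ⟨P, ⟨p, hp⟩, hP, hBB⟩ := hall n
    -- Without a square of a long block, the two blocks would alternate: `ABABABAB`.
    by_contra hcon
    have hAA : ∀ p ∈ P, p + blockLength n false ∈ P →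
        p + blockLength n false + blockLength n false ∈ P → OccursAt w p (block n false) →
        OccursAt w (p + blockLength n false) (block n false) → False := by
      intro p h0 h1 h2 o0 o1
      have := hP.repetition hc (block n false) (d := blockLength n false) (by omega) h0 h1
        (by simpa [length_block] using h1) (by simpa [length_block] using h2) o0 o1
      rw [length_block] at this
      apply hcon
      linarith
    have hA : ∃ p ∈ P, OccursAt w p (block n false) ∧ p + blockLength n false ∈ P := by
      obtain ⟨-, -, x, ox, hx⟩ := hP p hp
      cases x with
      | false => exact ⟨p, hp, ox, hx⟩
      | true =>
        obtain ⟨-, -, y, oy, hy⟩ := hP _ hx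
        cases y with
        | true => exact (hBB p hp hx hy ox oy).elim
        | false => exact ⟨_, hx, oy, hy⟩
    have hstep : ∀ p ∈ P, OccursAt w p (block n false) → p + blockLength n false ∈ P →
        OccursAt w p (block (n + 1) true) ∧
        p + blockLength (n + 1) true ∈ P ∧
        OccursAt w (p + blockLength (n + 1) true) (block n false) ∧
        p + blockLength (n + 1) true + blockLength n false ∈ P := by
      intro p hp o hpa
      simp only [block, blockLength, occursAt_append, length_block, ← Nat.add_assoc]
      obtain ⟨-, -, x, ox, hx⟩ := hP _ hpa
      cases x with
      | false => exact (hAA p hp hpa hx o ox).elim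
      | true =>
        obtain ⟨-, -, y, oy, hy⟩ := hP _ hx
        cases y with
        | true => exact (hBB _ hpa hx hy ox oy).elim
        | false => exact ⟨⟨o, ox⟩, hx, oy, hy⟩
    obtain ⟨p, hp, o, hpa⟩ := hA
    obtain ⟨o1, p1, q1, r1⟩ := hstep p hp o hpa
    obtain ⟨o2, p2, q2, r2⟩ := hstep _ p1 q1 r1
    obtain ⟨o3, p3, q3, r3⟩ := hstep _ p2 q2 r2
    obtain ⟨o4, p4, q4, r4⟩ := hstep _ p3 q3 r3
    set B := block (n + 1) true with hB
    have hlen : B.length = blockLength (n + 1) true := length_block _ _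
    have u1 : OccursAt w p (B ++ (B ++ B)) := by
      rw [occursAt_append, occursAt_append, hlen]
      exact ⟨o1, o2, o3⟩
    have u2 : OccursAt w (p + blockLength (n + 1) true) (B ++ (B ++ B)) := by
      rw [occursAt_append, occursAt_append, hlen]
      exact ⟨o2, o3, o4⟩
    have b3 := (blockLength_bounds (n + 1)).2
    have := hc _ _ _ (by omega) (u1.periodicOn u2)
    simp only [List.length_append, hlen] at this
    push_cast at this
    have b3' : ((n + 1 : ℕ) : ℝ) + 2 ≤ blockLength (n + 1) true := by exact_mod_cast b3
    have hn : (0 : ℝ) ≤ (n + 1 : ℕ) := Nat.cast_nonneg _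
    have := Real.goldenRatio_lt_two
    nlinarith
  obtain ⟨n, hn⟩ := exists_nat_gt (4 / (2 + Real.goldenRatio - c))
  have hpos : 0 < 2 + Real.goldenRatio - c := by linarith
  rw [div_lt_iff₀ hpos] at hn
  have b1 : (n : ℝ) + 4 ≤ blockLength n false := by exact_mod_cast (blockLength_bounds n).1
  obtain ⟨g1, g2⟩ := blockLength_golden n
  have h3 := goldenRatio_mul_self
  have h4 := Real.one_lt_goldenRatio
  -- Multiply `a - φ b ≤ 1` by `φ - 1 = 1 / φ`.
  have h5 : (Real.goldenRatio - 1) * blockLength n false - blockLength n true ≤ 1 := by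
    have e : (Real.goldenRatio - 1) * blockLength n false - blockLength n true =
      (Real.goldenRatio - 1) *
        ((blockLength n false : ℝ) - Real.goldenRatio * blockLength n true) := by
      linear_combination (blockLength n true : ℝ) * h3
    rw [e]
    have := Real.goldenRatio_lt_two
    nlinarith
  have := hsq n
  nlinarith

/-! ### The lower bound: good words are products of `0001` and `01` -/

@[simp]
theorem occursAt_nil (w : ℕ → Bool) (p : ℕ) : OccursAt w p [] := fun j hj => by simp at hj

@[simp]
theorem occursAt_cons {w : ℕ → Bool} {p : ℕ} {a : Bool} {u : List Bool} :
    OccursAt w p (a :: u) ↔ w p = a ∧ OccursAt w (p + 1) u := by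
  rw [← List.singleton_append, occursAt_append]
  refine and_congr_left fun _ => ⟨fun h => h 0 (by simp), fun h j hj => ?_⟩
  obtain rfl : j = 0 := by simpa using hj
  exact h

/-- The restrictions on short factors of good words with small critical exponent that determine
their structure. -/
structure LocallyGood (w : ℕ → Bool) : Prop where
  two : ∀ i, w i = w (i + 2) ∨ w (i + 1) = w (i + 3)
  three : ∀ i, w i = w (i + 3) ∨ w (i + 1) = w (i + 4) ∨ w (i + 2) = w (i + 5)
  five : ∀ i, w i = w (i + 5) ∨ w (i + 1) = w (i + 6) ∨ w (i + 2) = w (i + 7) ∨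
    w (i + 3) = w (i + 8) ∨ w (i + 4) = w (i + 9)
  four_letters : ∀ i, w i = w (i + 1) → w (i + 1) = w (i + 2) → w (i + 2) = w (i + 3) → False

theorem NoLongAntisquare.locallyGood {w : ℕ → Bool} (h : NoLongAntisquare w) {c : ℝ}
    (hc : ExponentsLE w c) (hlt : c < 2 + Real.goldenRatio) : LocallyGood w where
  two i := by
    obtain ⟨j, hj, e⟩ := h i 2 (by norm_num)
    interval_cases j <;> simp_all
  three i := by
    obtain ⟨j, hj, e⟩ := h i 3 (by norm_num)
    interval_cases j <;> simp_all
  five i := by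
    obtain ⟨j, hj, e⟩ := h i 5 (by norm_num)
    interval_cases j <;> simp_all
  four_letters i h0 h1 h2 := by
    have := hc 1 i 4 le_rfl (by
      intro k hk hk2
      obtain rfl | rfl | rfl : k = i ∨ k = i + 1 ∨ k = i + 2 := by omega
      · exact h0
      · exact h1
      · exact h2)
    have := Real.goldenRatio_lt_two
    push_cast at *
    linarith

theorem LocallyGood.not {w : ℕ → Bool} (h : LocallyGood w) : LocallyGood fun k => !w k where
  two i := by simpa using h.two i
  three i := by simpa using h.three i
  five i := by simpa using h.five i
  four_letters i := by simpa using h.four_letters i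

theorem LocallyGood.exists_cube {w : ℕ → Bool} (h : LocallyGood w) :
    ∃ i, w i = w (i + 1) ∧ w (i + 1) = w (i + 2) := by
  by_contra! hcon
  -- Without cubes of letters, an inner square of a letter is the middle of `0110` or `1001`.
  have hne : ∀ i, w (i + 1) = !w (i + 2) := by
    intro i
    rw [Bool.eq_not]
    intro e
    have h1 := hcon i
    have h2 := hcon (i + 1) e
    simp only [Nat.add_assoc, Nat.reduceAdd] at h2
    rcases h.two i with e' | e'
    · exact h1 (e'.trans e.symm) e
    · exact h2 (e.symm.trans e')
  have h3 := h.three 1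
  simp only [Nat.reduceAdd] at h3
  rw [hne 0, hne 1, hne 2, hne 3, hne 4] at h3
  simp at h3

/-- Cutting after each `0001`, and after each `01` that follows it, decomposes a word in which
`000` occurs. Only
`0001011` would lead elsewhere, but its next letters would be `101`, and `0001011101` is an
antisquare. -/
theorem LocallyGood.hasLevel_zero {w : ℕ → Bool} (h : LocallyGood w) {i : ℕ}
    (h0 : w i = false) (h1 : w (i + 1) = false) (h2 : w (i + 2) = false) : HasLevel w 0 := by
  let P : Set ℕ := {p | ∃ q, (q + 4 = p ∧ OccursAt w q [false, false, false, true]) ∨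
    (q + 6 = p ∧ OccursAt w q [false, false, false, true, false, true])}
  have hP : IsCutSet w 0 P := by
    rintro p ⟨q, ⟨rfl, hq⟩ | ⟨rfl, hq⟩⟩
    · simp only [occursAt_cons, occursAt_nil, and_true, Nat.add_assoc, Nat.reduceAdd] at hq
      obtain ⟨a0, a1, a2, a3⟩ := hq
      have z4 : w (q + 4) = false := by have := h.two (q + 1); grind
      refine ⟨⟨q + 2, by simp [leftContext], by simp [leftContext, a2, a3]⟩,
        by simp [rightContext, z4], ?_⟩
      rcases z5 : w (q + 5) with _ | _
      · have z6 : w (q + 6) = false := by have := h.two (q + 3); grind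
        have z7 : w (q + 7) = true := by have := h.four_letters (q + 4); grind
        exact ⟨false, by simp [block, z4, z5, z6, z7], q + 4,
          Or.inl ⟨by simp [blockLength], by simp [z4, z5, z6, z7]⟩⟩
      · exact ⟨true, by simp [block, z4, z5], q,
          Or.inr ⟨by simp [blockLength], by simp [a0, a1, a2, a3, z4, z5]⟩⟩
    · simp only [occursAt_cons, occursAt_nil, and_true, Nat.add_assoc, Nat.reduceAdd] at hq
      obtain ⟨a0, a1, a2, a3, a4, a5⟩ := hq
      have z6 : w (q + 6) = false := by
        by_contra z6
        have z7 : w (q + 7) = true := by have := h.two (q + 4); grind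
        have z8 : w (q + 8) = false := by have := h.four_letters (q + 5); grind
        have z9 : w (q + 9) = true := by have := h.two (q + 6); grind
        have := h.five q
        grind
      have z7 : w (q + 7) = false := by have := h.three (q + 2); grind
      have z8 : w (q + 8) = false := by have := h.two (q + 5); grind
      have z9 : w (q + 9) = true := by have := h.four_letters (q + 6); grind
      exact ⟨⟨q + 4, by simp [leftContext], by simp [leftContext, a4, a5]⟩,
        by simp [rightContext, z6], false, by simp [block, z6, z7, z8, z9], q + 6,
          Or.inl ⟨by simp [blockLength], by simp [z6, z7, z8, z9]⟩⟩
  refine ⟨P, ⟨i + 4, i, Or.inl ⟨rfl, ?_⟩⟩, hP, ?_⟩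
  · have := h.four_letters i
    simp [h0, h1, h2, Nat.add_assoc]
    grind
  · intro p hp _ _ o1 o2
    obtain ⟨⟨q, hq, oq⟩, -, -⟩ := hP p hp
    simp only [leftContext, block, blockLength, occursAt_cons, occursAt_nil, and_true,
      Nat.add_assoc, Nat.reduceAdd, List.length_cons, List.length_nil] at hq oq o1 o2
    subst hq
    have := h.three q
    grind

theorem le_criticalExponent_of_noLongAntisquare {w : ℕ → Bool} (h : NoLongAntisquare w) :
    ((2 + Real.goldenRatio : ℝ) : EReal) ≤ criticalExponent (rightFactors w) := by
  by_contra! hlt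
  obtain ⟨c, hc, hlt⟩ := EReal.lt_iff_exists_real_btwn.1 hlt
  rw [EReal.coe_lt_coe_iff] at hlt
  have hexp : ExponentsLE w c := by
    intro d i L hd hper
    have hd' : (0 : ℝ) < d := by exact_mod_cast hd
    have key : ∀ L, 1 ≤ L → PeriodicOn w d i (i + L) → (L : ℝ) ≤ c * d := by
      intro L hL hper
      have := (hper.le_criticalExponent hd hL).trans hc.le
      rwa [EReal.coe_le_coe_iff, div_le_iff₀ hd'] at this
    rcases Nat.eq_zero_or_pos L with rfl | hL
    · have := key 1 le_rfl fun k h1 h2 => by omega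
      push_cast at *
      linarith
    · exact key L hL hper
  have hgood := h.locallyGood hexp hlt
  obtain ⟨i, h0, h1⟩ := hgood.exists_cube
  rcases hi : w i with _ | _
  · exact not_hasLevel_zero hexp hlt
      (hgood.hasLevel_zero hi (h0.symm.trans hi) (h1.symm.trans (h0.symm.trans hi)))
  · have hexp' : ExponentsLE (fun k => !w k) c := fun d i L hd hper =>
      hexp d i L hd fun k h1 h2 => by simpa using hper k h1 h2
    refine not_hasLevel_zero hexp' hlt (hgood.not.hasLevel_zero (i := i) ?_ ?_ ?_)
    · simp [hi]
    · simp [← h0, hi]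
    · simp [← h1, ← h0, hi]

/-! ### Images of infinite words under morphisms -/

/-- The word `u` is the image of `s` under the morphism `h`, and `P m` is the position at which
the image of the letter `s m` begins. -/
structure IsImage (h : Bool → List Bool) (s u : ℕ → Bool) (P : ℕ → ℕ) : Prop where
  zero : P 0 = 0
  succ : ∀ m, P (m + 1) = P m + (h (s m)).length
  occursAt : ∀ m, OccursAt u (P m) (h (s m))

theorem isImage_of_occursAt_zero {h : Bool → List Bool} {s u : ℕ → Bool}
    (H : ∀ m, OccursAt u 0 (((List.range m).map s).flatMap h)) :
    IsImage h s u fun m => (((List.range m).map s).flatMap h).length where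
  zero := rfl
  succ m := by simp [List.range_succ]
  occursAt m := by
    have := H (m + 1)
    rw [List.range_succ, List.map_append, List.flatMap_append, occursAt_append] at this
    simpa using this.2

/-- A sequence of words of unbounded lengths, each a prefix of the next, has a limit. -/
theorem exists_limit (G : ℕ → List Bool) (hlen : ∀ n, n ≤ (G n).length)
    (hpre : ∀ n, G n <+: G (n + 1)) : ∃ u : ℕ → Bool, ∀ n, OccursAt u 0 (G n) := by
  have hmono : ∀ m n, m ≤ n → G m <+: G n := by
    intro m n hmn
    induction n, hmn using Nat.le_induction with
    | base => exact List.prefix_rfl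
    | succ n _ ih => exact ih.trans (hpre n)
  refine ⟨fun k => (G (k + 1))[k]'(hlen (k + 1)), fun n j hj => ?_⟩
  simp only [Nat.zero_add]
  rcases le_total n (j + 1) with hn | hn
  · exact ((hmono _ _ hn).getElem hj).symm
  · exact (hmono _ _ hn).getElem (hlen (j + 1))

theorem exists_isImage (h : Bool → List Bool) (hne : ∀ b, 1 ≤ (h b).length) (s : ℕ → Bool) :
    ∃ u P, IsImage h s u P := by
  have hsucc : ∀ n, ((List.range (n + 1)).map s).flatMap h =
      ((List.range n).map s).flatMap h ++ h (s n) := by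
    intro n
    simp [List.range_succ]
  obtain ⟨u, hu⟩ := exists_limit (fun n => ((List.range n).map s).flatMap h)
    (fun n => by
      induction n with
      | zero => simp
      | succ n ih =>
        rw [hsucc, List.length_append]
        have := hne (s n)
        omega)
    (fun n => by rw [hsucc]; exact List.prefix_append _ _)
  exact ⟨u, _, isImage_of_occursAt_zero hu⟩

/-- The morphism `A ↦ AAB`, `B ↦ AB`, a conjugate of the square of the Fibonacci morphism. -/
def fibMorphism : Bool → List Bool
  | false => [false, false, true]
  | true => [false, true]

/-- The coding `A ↦ 0001`, `B ↦ 01`. -/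
def codeMorphism : Bool → List Bool
  | false => [false, false, false, true]
  | true => [false, true]

theorem exists_fixedPoint : ∃ s P, IsImage fibMorphism s s P := by
  let G : ℕ → List Bool := fun n => (fun l : List Bool => l.flatMap fibMorphism)^[n] [false]
  have hG : ∀ n, G (n + 1) = (G n).flatMap fibMorphism := fun n =>
    Function.iterate_succ_apply' _ _ _
  have hpos : ∀ n, [false] <+: G n := by
    intro n
    induction n with
    | zero => exact List.prefix_rfl
    | succ n ih =>
      obtain ⟨t, ht⟩ := ih
      rw [hG, ← ht]
      simp [fibMorphism]
  have hpre : ∀ n, G n <+: G (n + 1) := by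
    intro n
    induction n with
    | zero => simp [G, fibMorphism]
    | succ n ih =>
      rw [hG n, hG (n + 1)]
      exact ih.flatMap _
  have hgrow : ∀ l : List Bool, 2 * l.length ≤ (l.flatMap fibMorphism).length := by
    intro l
    induction l with
    | nil => simp
    | cons a l ih => cases a <;> simp [fibMorphism] at * <;> omega
  have hlen : ∀ n, n + 1 ≤ (G n).length := by
    intro n
    induction n with
    | zero => simp [G]
    | succ n ih =>
      have := hgrow (G n)
      rw [hG]
      omega
  obtain ⟨s, hs⟩ := exists_limit G (fun n => (Nat.le_succ n).trans (hlen n)) hpre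
  refine ⟨s, _, isImage_of_occursAt_zero fun m => ?_⟩
  have htake : (List.range m).map s <+: G m := by
    rw [List.prefix_iff_getElem?]
    intro i hi
    simp only [List.length_map, List.length_range] at hi
    have := hs m i (by have := hlen m; omega)
    rw [Nat.zero_add] at this
    rw [List.getElem?_eq_getElem (by have := hlen m; omega), ← this]
    simp
  obtain ⟨t, ht⟩ := htake.flatMap fibMorphism
  have := hs (m + 1)
  rw [hG, ← ht, occursAt_append] at this
  exact this.1

theorem IsImage.strictMono {h : Bool → List Bool} {s u : ℕ → Bool} {P : ℕ → ℕ}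
    (H : IsImage h s u P) (hne : ∀ b, 1 ≤ (h b).length) : StrictMono P :=
  strictMono_nat_of_lt_succ fun m => by
    rw [H.succ]
    have := hne (s m)
    omega

theorem IsImage.exists_block {h : Bool → List Bool} {s u : ℕ → Bool} {P : ℕ → ℕ}
    (H : IsImage h s u P) (hne : ∀ b, 1 ≤ (h b).length) (k : ℕ) :
    ∃ m, P m ≤ k ∧ k < P (m + 1) := by
  have hmono := H.strictMono hne
  induction k with
  | zero => exact ⟨0, H.zero.le, by have := hmono (Nat.lt_add_one 0); omega⟩
  | succ k ih =>
    obtain ⟨m, h1, h2⟩ := ih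
    rcases Nat.lt_or_ge (k + 1) (P (m + 1)) with h3 | h3
    · exact ⟨m, by omega, h3⟩
    · exact ⟨m + 1, h3, by have := hmono (Nat.lt_add_one (m + 1)); omega⟩

/-- A repetition that begins and ends at block boundaries, and whose period leads from one block
boundary to another, is the image of a repetition, when the second letter of each block
determines it. -/
theorem IsImage.periodicOn {h : Bool → List Bool} {s u : ℕ → Bool} {P : ℕ → ℕ}
    (H : IsImage h s u P) (hsnd : ∀ b, (h b)[1]? = some b) {q a b e : ℕ}
    (hper : PeriodicOn u q (P a) (P b)) (hae : a ≤ e) (he : P e = P a + q) :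
    PeriodicOn s (e - a) a b := by
  have hlen : ∀ b, 2 ≤ (h b).length := fun b => by
    by_contra! hlt
    have := hsnd b
    rw [List.getElem?_eq_none (by omega)] at this
    simp at this
  have hmono := H.strictMono fun b => by have := hlen b; omega
  have hletter : ∀ m, u (P m + 1) = s m := by
    intro m
    have := H.occursAt m 1 (hlen _)
    rw [this]
    have := hsnd (s m)
    rwa [List.getElem?_eq_getElem (hlen _), Option.some.injEq] at this
  have hstep : ∀ t, e + t < b → P (e + t) = P (a + t) + q → s (a + t) = s (e + t) := by
    intro t hb hP
    have h1 := H.succ (e + t)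
    have h2 : P (e + t + 1) ≤ P b := hmono.monotone hb
    have h3 := hlen (s (e + t))
    have h4 : P a ≤ P (a + t) := hmono.monotone (Nat.le_add_right _ _)
    have := hper (P (a + t) + 1) (by omega) (by omega)
    rwa [show P (a + t) + 1 + q = P (e + t) + 1 by omega, hletter, hletter] at this
  have hpos : ∀ t, e + t < b → P (e + t) = P (a + t) + q := by
    intro t
    induction t with
    | zero => intro _; exact he
    | succ t ih =>
      intro hb
      have hPt := ih (by omega)
      rw [← Nat.add_assoc, ← Nat.add_assoc, H.succ, H.succ, hstep t (by omega) hPt, hPt]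
      omega
  intro k hk hkb
  have := hstep (k - a) (by omega) (hpos _ (by omega))
  rwa [show a + (k - a) = k by omega, show e + (k - a) = k + (e - a) by omega] at this

/-! ### Repetitions in the fixed point of the Fibonacci morphism -/

/-- The length of the product of the blocks of level `n` coded by the first `k` letters
of `s`. -/
def prefixWeight (s : ℕ → Bool) (n k : ℕ) : ℕ := ∑ t ∈ Finset.range k, blockLength n (s t)

theorem prefixWeight_succ (s : ℕ → Bool) (n k : ℕ) :
    prefixWeight s n (k + 1) = prefixWeight s n k + blockLength n (s k) :=
  Finset.sum_range_succ _ _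

theorem prefixWeight_mono (s : ℕ → Bool) (n : ℕ) : Monotone (prefixWeight s n) :=
  monotone_nat_of_le_succ fun k => by rw [prefixWeight_succ]; omega

theorem PeriodicOn.prefixWeight_add {s : ℕ → Bool} {q i j : ℕ} (h : PeriodicOn s q i j) (n t : ℕ)
    (ht : i + q + t ≤ j) :
    prefixWeight s n (i + q + t) + prefixWeight s n i =
      prefixWeight s n (i + t) + prefixWeight s n (i + q) := by
  induction t with
  | zero => simp only [Nat.add_zero]; omega
  | succ t ih =>
    have := ih (by omega)
    have e := h (i + t) (by omega) (by omega)
    rw [← Nat.add_assoc, ← Nat.add_assoc, prefixWeight_succ, prefixWeight_succ, e,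
      show i + t + q = i + q + t by omega]
    omega

/-- The constraints on the letters of a fixed point of the Fibonacci morphism: blocks end
exactly after the letters `B = true`, and `AA` occurs only at the beginning of a block. -/
structure FibLocal (s : ℕ → Bool) (P : ℕ → ℕ) : Prop where
  first : ∀ m, s (P m) = false
  second : ∀ m, s (P m + 1) = s m
  long : ∀ m, s m = false → s (P m + 2) = true ∧ P (m + 1) = P m + 3
  short : ∀ m, s m = true → P (m + 1) = P m + 2
  after_true : ∀ k, s k = true → ∃ m, P m = k + 1
  two_false : ∀ k, s k = false → s (k + 1) = false → ∃ m, P m = k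

theorem fibMorphism_length_pos (b : Bool) : 1 ≤ (fibMorphism b).length := by
  cases b <;> simp [fibMorphism]

theorem IsImage.fibLocal {s : ℕ → Bool} {P : ℕ → ℕ} (H : IsImage fibMorphism s s P) :
    FibLocal s P := by
  have first : ∀ m, s (P m) = false := by
    intro m
    have := H.occursAt m
    rcases hm : s m with _ | _ <;> rw [hm] at this <;> simp [fibMorphism] at this <;> exact this.1
  have second : ∀ m, s (P m + 1) = s m := by
    intro m
    have := H.occursAt m
    rcases hm : s m with _ | _ <;> rw [hm] at this <;> simp [fibMorphism] at this
    · exact this.2.1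
    · exact this.2
  have long : ∀ m, s m = false → s (P m + 2) = true ∧ P (m + 1) = P m + 3 := by
    intro m hm
    have := H.occursAt m
    rw [H.succ]
    rw [hm] at this ⊢
    simp [fibMorphism, Nat.add_assoc] at this ⊢
    exact this.2.2
  have short : ∀ m, s m = true → P (m + 1) = P m + 2 := by
    intro m hm
    rw [H.succ, hm]
    simp [fibMorphism]
  refine ⟨first, second, long, short, ?_, ?_⟩
  · intro k hk
    obtain ⟨m, h1, h2⟩ := H.exists_block fibMorphism_length_pos k
    refine ⟨m + 1, ?_⟩
    have f := first m
    have g := second m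
    rcases hm : s m with _ | _
    · have hl := long m hm
      obtain h | h | h : k = P m ∨ k = P m + 1 ∨ k = P m + 2 := by omega
      all_goals subst h; simp_all
    · have hl := short m hm
      obtain h | h : k = P m ∨ k = P m + 1 := by omega
      all_goals subst h; simp_all
  · intro k hk hk1
    obtain ⟨m, h1, h2⟩ := H.exists_block fibMorphism_length_pos k
    refine ⟨m, ?_⟩
    have f := first m
    have g := second m
    rcases hm : s m with _ | _
    · have hl := long m hm
      obtain h | h | h : k = P m ∨ k = P m + 1 ∨ k = P m + 2 := by omega
      all_goals subst h; simp_all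
    · have hl := short m hm
      obtain h | h : k = P m ∨ k = P m + 1 := by omega
      all_goals subst h; simp_all

namespace FibLocal

variable {s : ℕ → Bool} {P : ℕ → ℕ}

theorem not_true_true (H : FibLocal s P) {k : ℕ} (h0 : s k = true) : s (k + 1) = false := by
  obtain ⟨m, hm⟩ := H.after_true k h0
  rw [← hm, H.first]

theorem true_of_two_false (H : FibLocal s P) {k : ℕ} (h0 : s k = false) (h1 : s (k + 1) = false) :
    s (k + 2) = true := by
  obtain ⟨m, rfl⟩ := H.two_false k h0 h1
  rw [H.second] at h1
  exact (H.long m h1).1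

theorem prefixWeight_start (H : FibLocal s P) (h0 : P 0 = 0) (n m : ℕ) :
    prefixWeight s n (P m) = prefixWeight s (n + 1) m := by
  induction m with
  | zero => simp [h0, prefixWeight]
  | succ m ih =>
    have f := H.first m
    have g := H.second m
    rw [prefixWeight_succ s (n + 1), ← ih]
    rcases hm : s m with _ | _
    · obtain ⟨h1, h2⟩ := H.long m hm
      rw [hm] at g
      rw [h2, prefixWeight_succ, prefixWeight_succ, prefixWeight_succ, f, g, h1]
      simp only [blockLength]
      omega
    · rw [hm] at g
      rw [H.short m hm, prefixWeight_succ, prefixWeight_succ, f, g]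
      simp only [blockLength]
      omega

/-- A repetition longer than twice its period can be shortened or extended at either end so as to
begin and end at block boundaries. -/
theorem exists_boundaries (H : FibLocal s P) {q i j : ℕ} (hq : 2 ≤ q) (hj : i + 2 * q < j)
    (hper : PeriodicOn s q i j) (n : ℕ) :
    ∃ a b e, i ≤ P a ∧ P a ≤ i + 2 ∧ P e = P a + q ∧ P e ≤ P b ∧ PeriodicOn s q (P a) (P b) ∧
      prefixWeight s n (P a) ≤ prefixWeight s n i + blockLength n false + blockLength n true ∧
      prefixWeight s n j ≤ prefixWeight s n (P b) + blockLength n false := by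
  have hleft : ∃ a e, i ≤ P a ∧ P a ≤ i + 2 ∧ P e = P a + q ∧
      prefixWeight s n (P a) ≤ prefixWeight s n i + blockLength n false + blockLength n true := by
    rcases h0 : s i with _ | _
    · rcases h1 : s (i + 1) with _ | _
      · obtain ⟨a, ha⟩ := H.two_false i h0 h1
        obtain ⟨e, he⟩ := H.two_false (i + q) (by rw [← hper i le_rfl (by omega), h0])
          (by rw [show i + q + 1 = i + 1 + q by omega, ← hper _ (by omega) (by omega), h1])
        exact ⟨a, e, by omega, by omega, by omega, by rw [ha]; omega⟩
      · obtain ⟨a, ha⟩ := H.after_true (i + 1) h1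
        obtain ⟨e, he⟩ := H.after_true (i + 1 + q)
          (by rw [← hper _ (by omega) (by omega), h1])
        refine ⟨a, e, by omega, by omega, by omega, ?_⟩
        rw [ha, prefixWeight_succ, prefixWeight_succ, h0, h1]
    · obtain ⟨a, ha⟩ := H.after_true i h0
      obtain ⟨e, he⟩ := H.after_true (i + q) (by rw [← hper _ le_rfl (by omega), h0])
      refine ⟨a, e, by omega, by omega, by omega, ?_⟩
      rw [ha, prefixWeight_succ, h0]
      omega
  have hright : ∃ b, j ≤ P b + 1 ∧ PeriodicOn s q i (P b) ∧
      prefixWeight s n j ≤ prefixWeight s n (P b) + blockLength n false := by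
    obtain ⟨j, rfl⟩ : ∃ j', j = j' + 2 := ⟨j - 2, by omega⟩
    rcases h1 : s (j + 1) with _ | _
    · rcases h0 : s j with _ | _
      · -- A repetition ending in `AA` can be extended by the letter `B`.
        have h2 := H.true_of_two_false h0 h1
        obtain ⟨b, hb⟩ := H.after_true (j + 2) h2
        refine ⟨b, by omega, ?_, (prefixWeight_mono s n (by omega)).trans (Nat.le_add_right _ _)⟩
        intro k hk hkb
        rcases Nat.lt_or_ge (k + q) (j + 2) with hlt | hge
        · exact hper k hk hlt
        · rw [show k + q = j + 2 by omega, h2]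
          obtain ⟨k, rfl⟩ : ∃ k', k = k' + 2 := ⟨k - 2, by omega⟩
          apply H.true_of_two_false
          · rw [hper k (by omega) (by omega), show k + q = j by omega, h0]
          · rw [hper (k + 1) (by omega) (by omega), show k + 1 + q = j + 1 by omega, h1]
      · obtain ⟨b, hb⟩ := H.after_true j h0
        refine ⟨b, by omega, fun k hk hkb => hper k hk (by omega), ?_⟩
        rw [hb, prefixWeight_succ s n (j + 1), h1]
    · obtain ⟨b, hb⟩ := H.after_true (j + 1) h1
      exact ⟨b, by omega, fun k hk hkb => hper k hk (by omega), by
        rw [hb]; exact Nat.le_add_right _ _⟩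
  obtain ⟨a, e, h1, h2, h3, h4⟩ := hleft
  obtain ⟨b, h5, h6, h7⟩ := hright
  exact ⟨a, b, e, h1, h2, h3, by omega, fun k hk hkb => h6 k (by omega) hkb, h4, h7⟩

end FibLocal

theorem two_mul_sub_le (P : ℕ → ℕ) (h : ∀ m, P m + 2 ≤ P (m + 1)) {a e : ℕ} (hae : a ≤ e) :
    P a + 2 * (e - a) ≤ P e := by
  induction e, hae using Nat.le_induction with
  | base => simp
  | succ e hae ih => have := h e; omega

theorem fibMorphism_second (b : Bool) : (fibMorphism b)[1]? = some b := by
  cases b <;> rfl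

/-- The bound on repetitions in the fixed point, measured with the block lengths of level `n` and
including the contexts that extend a repetition of blocks. By induction on the period: cutting
into blocks gives a repetition with a smaller period and the weights of the next level, until the
period is `A` or `B`. -/
theorem IsImage.prefixWeight_lt {s : ℕ → Bool} {P : ℕ → ℕ} (H : IsImage fibMorphism s s P)
    (q : ℕ) : ∀ n i j, 1 ≤ q → i + q ≤ j → PeriodicOn s q i j →
      (prefixWeight s n j : ℝ) - prefixWeight s n i + blockLength n false + blockLength n true - 3 <
        (2 + Real.goldenRatio) * (prefixWeight s n (i + q) - prefixWeight s n i) := by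
  induction q using Nat.strong_induction_on with
  | _ q IH =>
  intro n i j hq hqj hper
  have F := H.fibLocal
  have g1 := Real.one_lt_goldenRatio
  have g2 := Real.goldenRatio_lt_two
  have g3 := goldenRatio_mul_self
  have g4 : 1.6 < Real.goldenRatio := by nlinarith
  obtain ⟨l1, l2⟩ := blockLength_golden n
  obtain ⟨b1, b2⟩ := blockLength_bounds n
  have hn : (0 : ℝ) ≤ n := n.cast_nonneg
  have b1' : (n : ℝ) + 4 ≤ blockLength n false := by exact_mod_cast b1
  have b2' : (n : ℝ) + 2 ≤ blockLength n true := by exact_mod_cast b2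
  set A : ℝ := (blockLength n false : ℝ) with hA
  set B : ℝ := (blockLength n true : ℝ) with hB
  have hw : ∀ k, (prefixWeight s n (k + 1) : ℝ) = prefixWeight s n k + blockLength n (s k) := by
    intro k
    rw [prefixWeight_succ]
    push_cast
    rfl
  have hAB : B ≤ (Real.goldenRatio - 1) * A := by nlinarith
  by_cases hlong : i + 2 * q < j
  · rcases Nat.lt_or_ge q 2 with hq2 | hq2
    · -- A repetition with period one letter has at most two letters.
      obtain rfl : q = 1 := by omega
      have h1 := hper i le_rfl (by omega)
      have h2 := hper (i + 1) (by omega) (by omega)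
      exfalso
      rcases h0 : s i with _ | _
      · have := F.true_of_two_false h0 (by rw [← h1, h0])
        simp_all
      · have := F.not_true_true h0
        simp_all
    · obtain ⟨a, b, e, hia, hai, he, heb, hper', hl, hr⟩ := F.exists_boundaries hq2 hlong hper n
      have hmono := H.strictMono fibMorphism_length_pos
      have hae : a < e := hmono.lt_iff_lt.1 (by omega)
      have heb' : e ≤ b := hmono.le_iff_le.1 heb
      have hgrow : ∀ m, P m + 2 ≤ P (m + 1) := by
        intro m
        rcases hm : s m with _ | _
        · have := (F.long m hm).2; omega
        · have := F.short m hm; omega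
      have hlt := two_mul_sub_le P hgrow hae.le
      have ih := IH (e - a) (by omega) (n + 1) a b (by omega) (by omega)
        (H.periodicOn fibMorphism_second hper' hae.le he)
      rw [show a + (e - a) = e by omega, ← F.prefixWeight_start H.zero,
        ← F.prefixWeight_start H.zero, ← F.prefixWeight_start H.zero, he] at ih
      have hrot := hper.prefixWeight_add n (P a - i) (by omega)
      rw [show i + q + (P a - i) = P a + q by omega, show i + (P a - i) = P a by omega] at hrot
      have hrot' : (prefixWeight s n (P a + q) : ℝ) + prefixWeight s n i =
        prefixWeight s n (P a) + prefixWeight s n (i + q) := by exact_mod_cast hrot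
      have hl' : (prefixWeight s n (P a) : ℝ) ≤ prefixWeight s n i + A + B := by
        rw [hA, hB]
        exact_mod_cast hl
      have hr' : (prefixWeight s n j : ℝ) ≤ prefixWeight s n (P b) + A := by
        rw [hA]
        exact_mod_cast hr
      simp only [blockLength] at ih
      push_cast at ih
      rw [show (prefixWeight s n (P a + q) : ℝ) - prefixWeight s n (P a) =
        prefixWeight s n (i + q) - prefixWeight s n i by linarith] at ih
      linarith
  · -- The total weight is at most twice that of a period.
    have hrot := hper.prefixWeight_add n (j - (i + q)) (by omega)
    rw [show i + q + (j - (i + q)) = j by omega] at hrot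
    have hle := prefixWeight_mono s n (show i + (j - (i + q)) ≤ i + q by omega)
    have hW : (prefixWeight s n j : ℝ) - prefixWeight s n i ≤
        2 * (prefixWeight s n (i + q) - prefixWeight s n i) := by
      have h1 : (prefixWeight s n j : ℝ) + prefixWeight s n i =
        prefixWeight s n (i + (j - (i + q))) + prefixWeight s n (i + q) := by exact_mod_cast hrot
      have h2 : (prefixWeight s n (i + (j - (i + q))) : ℝ) ≤ prefixWeight s n (i + q) := by
        exact_mod_cast hle
      linarith
    obtain hq1 | hq2 : q = 1 ∨ 2 ≤ q := by omega
    · subst hq1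
      rw [hw i] at hW ⊢
      rcases h0 : s i with _ | _
      · rw [h0] at hW
        nlinarith
      · -- Since `BB` does not occur, the repetition is a single letter.
        obtain rfl : j = i + 1 := by
          by_contra hne
          have h1 := hper i le_rfl (by omega)
          have := F.not_true_true h0
          simp_all
        rw [hw i, h0]
        nlinarith
    · have hp : A + B ≤ prefixWeight s n (i + q) - prefixWeight s n i ∨
          (2 * A ≤ prefixWeight s n (i + q) - prefixWeight s n i) := by
        have hm : (prefixWeight s n (i + 1 + 1) : ℝ) ≤ prefixWeight s n (i + q) := by
          exact_mod_cast prefixWeight_mono s n (show i + 1 + 1 ≤ i + q by omega)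
        rw [hw, hw] at hm
        rcases h0 : s i with _ | _ <;> rcases h1 : s (i + 1) with _ | _ <;> rw [h0, h1] at hm
        · right; linarith
        · left; linarith
        · left; linarith
        · have := F.not_true_true h0
          simp_all
      have hBA : B ≤ A := by nlinarith
      have hmul := mul_le_mul_of_nonneg_right g1.le
        (show (0 : ℝ) ≤ prefixWeight s n (i + q) - prefixWeight s n i by
          rcases hp with hp | hp <;> linarith)
      rcases hp with hp | hp <;> linarith

/-! ### The coded word -/

theorem codeMorphism_length_pos (b : Bool) : 1 ≤ (codeMorphism b).length := by
  cases b <;> simp [codeMorphism]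

theorem codeMorphism_second (b : Bool) : (codeMorphism b)[1]? = some b := by
  cases b <;> rfl

/-- The constraints on the letters of a product of blocks `0001` and `01` that begin at the
positions `P m`. -/
structure CodeLocal (w : ℕ → Bool) (P : ℕ → ℕ) : Prop where
  start : ∀ m, w (P m) = false
  cases : ∀ m, (w (P m + 1) = true ∧ P (m + 1) = P m + 2) ∨
    (w (P m + 1) = false ∧ w (P m + 2) = false ∧ w (P m + 3) = true ∧ P (m + 1) = P m + 4)
  after_true : ∀ k, w k = true → ∃ m, P m = k + 1
  exists_block : ∀ k, ∃ m, P m ≤ k ∧ k < P (m + 1)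

theorem IsImage.codeLocal {s w : ℕ → Bool} {P : ℕ → ℕ} (H : IsImage codeMorphism s w P) :
    CodeLocal w P := by
  have start : ∀ m, w (P m) = false := by
    intro m
    have := H.occursAt m
    rcases hm : s m with _ | _ <;> rw [hm] at this <;> simp [codeMorphism] at this <;> exact this.1
  have hcases : ∀ m, (w (P m + 1) = true ∧ P (m + 1) = P m + 2) ∨
      (w (P m + 1) = false ∧ w (P m + 2) = false ∧ w (P m + 3) = true ∧ P (m + 1) = P m + 4) := by
    intro m
    have := H.occursAt m
    rw [H.succ]
    rcases hm : s m with _ | _ <;> rw [hm] at this <;>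
      simp [codeMorphism, Nat.add_assoc] at this ⊢
    · exact this.2
    · exact this.2
  have hblock := H.exists_block codeMorphism_length_pos
  refine ⟨start, hcases, fun k hk => ?_, hblock⟩
  obtain ⟨m, h1, h2⟩ := hblock k
  refine ⟨m + 1, ?_⟩
  have f := start m
  rcases hcases m with ⟨c1, c2⟩ | ⟨c1, c2, c3, c4⟩
  · obtain h | h : k = P m ∨ k = P m + 1 := by omega
    all_goals subst h; simp_all
  · obtain h | h | h | h : k = P m ∨ k = P m + 1 ∨ k = P m + 2 ∨ k = P m + 3 := by omega
    all_goals subst h; simp_all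

namespace CodeLocal

variable {w : ℕ → Bool} {P : ℕ → ℕ}

/-- After `1` comes a block. -/
theorem after (H : CodeLocal w P) {k : ℕ} (hk : w k = true) :
    w (k + 1) = false ∧ (w (k + 2) = true ∨
      (w (k + 2) = false ∧ w (k + 3) = false ∧ w (k + 4) = true)) := by
  obtain ⟨m, hm⟩ := H.after_true k hk
  have h1 := H.start m
  have h2 := H.cases m
  rw [hm] at h1 h2
  simp only [Nat.add_assoc, Nat.reduceAdd] at h1 h2
  exact ⟨h1, by tauto⟩

/-- Two letters `00` begin at the first or the second position of a block `0001`. -/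
theorem two_false (H : CodeLocal w P) {k : ℕ} (h0 : w k = false) (h1 : w (k + 1) = false) :
    (w (k + 2) = false ∧ ∃ m, P m = k) ∨
      (w (k + 2) = true ∧ ∃ m, P m + 1 = k) := by
  obtain ⟨m, h2, h3⟩ := H.exists_block k
  have f := H.start m
  rcases H.cases m with ⟨c1, c2⟩ | ⟨c1, c2, c3, c4⟩
  · obtain h | h : k = P m ∨ k = P m + 1 := by omega
    all_goals subst h; simp_all
  · obtain h | h | h | h : k = P m ∨ k = P m + 1 ∨ k = P m + 2 ∨ k = P m + 3 := by omega
    · subst h; exact Or.inl ⟨c2, m, rfl⟩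
    · subst h; exact Or.inr ⟨c3, m, rfl⟩
    all_goals subst h; simp_all

end CodeLocal

theorem IsImage.prefixWeight_code {s w : ℕ → Bool} {P : ℕ → ℕ} (H : IsImage codeMorphism s w P)
    (m : ℕ) : prefixWeight s 0 m = P m := by
  induction m with
  | zero => simp [prefixWeight, H.zero]
  | succ m ih =>
    rw [prefixWeight_succ, ih, H.succ]
    rcases s m with _ | _ <;> rfl

/-- A repetition in the coded word longer than three times its period can be shortened, by at most
three letters in all, or extended so as to begin and end at block boundaries. -/
theorem CodeLocal.exists_boundaries {w : ℕ → Bool} {P : ℕ → ℕ} (H : CodeLocal w P) {q i j : ℕ}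
    (hq : 1 ≤ q) (hj : i + 3 * q < j) (hper : PeriodicOn w q i j) :
    ∃ a b e, P a ≤ i + 2 ∧ P e = P a + q ∧ P e ≤ P b ∧ j ≤ P b + 1 ∧
      PeriodicOn w q (P a) (P b) := by
  have hleft : ∃ a e, P a ≤ i + 2 ∧ P e = P a + q ∧
      ∀ k, P a ≤ k → k < i → w k = w (k + q) := by
    have hval : ∀ t, t ≤ 2 → w (i + q + t) = w (i + t) := by
      intro t ht
      rw [hper (i + t) (by omega) (by omega), show i + q + t = i + t + q by omega]
    rcases h0 : w i with _ | _
    · rcases h1 : w (i + 1) with _ | _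
      · have h0' := hval 0 (by omega)
        have h1' := hval 1 (by omega)
        have h2' := hval 2 (by omega)
        rcases H.two_false h0 h1 with ⟨h2, a, ha⟩ | ⟨h2, a, ha⟩ <;>
        rcases H.two_false (h0'.trans h0) (h1'.trans h1) with ⟨h3, e, he⟩ | ⟨h3, e, he⟩
        · exact ⟨a, e, by omega, by omega, fun k _ _ => by omega⟩
        · simp_all
        · simp_all
        · -- A repetition beginning with `001` can be extended to the left by the letter `0`.
          refine ⟨a, e, by omega, by omega, fun k hk1 hk2 => ?_⟩
          obtain rfl : k = P a := by omega
          rw [H.start, show P a + q = P e by omega, H.start]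
      · obtain ⟨a, ha⟩ := H.after_true (i + 1) h1
        obtain ⟨e, he⟩ := H.after_true (i + q + 1) ((hval 1 (by omega)).trans h1)
        exact ⟨a, e, by omega, by omega, fun k _ _ => by omega⟩
    · obtain ⟨a, ha⟩ := H.after_true i h0
      obtain ⟨e, he⟩ := H.after_true (i + q) ((hval 0 (by omega)).trans h0)
      exact ⟨a, e, by omega, by omega, fun k _ _ => by omega⟩
  have hright : ∃ b, j ≤ P b + 1 ∧ ∀ k, j ≤ k + q → k + q < P b → w k = w (k + q) := by
    obtain ⟨r, rfl⟩ : ∃ r, j = r + 3 := ⟨j - 3, by omega⟩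
    obtain ⟨t, rfl⟩ : ∃ t, r = t + q := ⟨r - q, by omega⟩
    have hval : ∀ u, u ≤ 2 → w (t + u) = w (t + q + u) := by
      intro u hu
      rw [hper (t + u) (by omega) (by omega), show t + q + u = t + u + q by omega]
    rcases h2 : w (t + q + 2) with _ | _
    · rcases h1 : w (t + q + 1) with _ | _
      · have e0 := hval 0 (by omega)
        have e1 := hval 1 (by omega)
        have e2 := hval 2 (by omega)
        rcases h0 : w (t + q) with _ | _
        · -- `000` at the end can be extended to `0001`.
          have h3 : ∀ x, w x = false → w (x + 1) = false → w (x + 2) = false →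
              w (x + 3) = true := by
            intro x x0 x1 x2
            rcases H.two_false x0 x1 with ⟨-, m, rfl⟩ | ⟨h, -⟩
            · rcases H.cases m with c | c <;> simp_all
            · simp_all
          have h3' := h3 _ h0 h1 h2
          have h3'' := h3 t (e0.trans h0) (e1.trans h1) (e2.trans h2)
          obtain ⟨b, hb⟩ := H.after_true _ h3'
          refine ⟨b, by omega, fun k hk1 hk2 => ?_⟩
          obtain rfl : k = t + 3 := by omega
          rw [h3'', show t + 3 + q = t + q + 3 by omega, h3']
        · -- `100` at the end can be extended to `10001`.
          have h3 : ∀ x, w x = true → w (x + 1) = false → w (x + 2) = false →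
              w (x + 3) = false ∧ w (x + 4) = true := by
            intro x x0 x1 x2
            have := H.after x0
            simp_all
          have h3' := h3 _ h0 h1 h2
          have h3'' := h3 t (e0.trans h0) (e1.trans h1) (e2.trans h2)
          obtain ⟨b, hb⟩ := H.after_true _ h3'.2
          refine ⟨b, by omega, fun k hk1 hk2 => ?_⟩
          obtain rfl | rfl : k = t + 3 ∨ k = t + 4 := by omega
          · rw [h3''.1, show t + 3 + q = t + q + 3 by omega, h3'.1]
          · rw [h3''.2, show t + 4 + q = t + q + 4 by omega, h3'.2]
      · obtain ⟨b, hb⟩ := H.after_true _ h1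
        exact ⟨b, by omega, fun k _ _ => by omega⟩
    · obtain ⟨b, hb⟩ := H.after_true _ h2
      exact ⟨b, by omega, fun k _ _ => by omega⟩
  obtain ⟨a, e, h1, h2, h3⟩ := hleft
  obtain ⟨b, h4, h5⟩ := hright
  refine ⟨a, b, e, h1, h2, by omega, h4, fun k hk hkb => ?_⟩
  rcases Nat.lt_or_ge k i with hki | hki
  · exact h3 k hk hki
  · rcases Nat.lt_or_ge (k + q) j with hkj | hkj
    · exact hper k hki hkj
    · exact h5 k hkj hkb

theorem criticalExponent_code_le {s w : ℕ → Bool} {P Q : ℕ → ℕ} (Hs : IsImage fibMorphism s s P)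
    (Hw : IsImage codeMorphism s w Q) :
    criticalExponent (rightFactors w) ≤ ((2 + Real.goldenRatio : ℝ) : EReal) := by
  refine criticalExponent_le fun q i j hq hqj hper => ?_
  have g1 := Real.one_lt_goldenRatio
  have hq' : (1 : ℝ) ≤ q := by exact_mod_cast hq
  rcases Nat.lt_or_ge (i + 3 * q) j with hj | hj
  · obtain ⟨a, b, e, h1, h2, h3, h4, h5⟩ := Hw.codeLocal.exists_boundaries hq hj hper
    have hmono := Hw.strictMono codeMorphism_length_pos
    have hae : a < e := hmono.lt_iff_lt.1 (by omega)
    have heb : e ≤ b := hmono.le_iff_le.1 h3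
    have := Hs.prefixWeight_lt (e - a) 0 a b (by omega) (by omega)
      (Hw.periodicOn codeMorphism_second h5 hae.le h2)
    rw [show a + (e - a) = e by omega, Hw.prefixWeight_code, Hw.prefixWeight_code,
      Hw.prefixWeight_code, h2] at this
    simp only [blockLength] at this
    push_cast at this
    have h1' : (Q a : ℝ) ≤ i + 2 := by exact_mod_cast h1
    have h4' : (j : ℝ) ≤ Q b + 1 := by exact_mod_cast h4
    rw [add_sub_cancel_left] at this
    linarith
  · have : (j : ℝ) ≤ i + 3 * q := by exact_mod_cast hj
    nlinarith

/-- The coded word does not contain `11`, so in an antisquare neither half contains `11` or `00`.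
Both halves alternate, and around the centre one finds `11`, `1001` or `10101` (or a contradiction,
if the halves have length two), none of which occurs. -/
theorem noLongAntisquare_code {s w : ℕ → Bool} {P Q : ℕ → ℕ} (Hs : IsImage fibMorphism s s P)
    (Hw : IsImage codeMorphism s w Q) : NoLongAntisquare w := by
  have C := Hw.codeLocal
  have F := Hs.fibLocal
  have hletter : ∀ m, w (Q m + 1) = s m := by
    intro m
    have := Hw.occursAt m
    rcases hm : s m with _ | _ <;> rw [hm] at this <;> simp [codeMorphism] at this
    · exact this.2.1
    · exact this.2
  -- `10101` is `1` followed by two blocks `01`, which come from `BB`.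
  have h10101 : ∀ k, w k = true → w (k + 2) = true → w (k + 4) = true → False := by
    intro k h0 h2 h4
    obtain ⟨m, hm⟩ := C.after_true k h0
    have e : Q (m + 1) = Q m + 2 := by
      rcases C.cases m with c | c
      · exact c.2
      · rw [hm] at c; simp_all
    have s0 := hletter m
    have s1 := hletter (m + 1)
    rw [e, hm] at s1
    rw [hm] at s0
    simp only [Nat.add_assoc, Nat.reduceAdd] at s0 s1
    have := F.not_true_true (s0.symm.trans h2)
    simp_all
  intro i n hn
  by_contra! hcon
  have hcon' : ∀ j < n, w (i + n + j) = !w (i + j) := fun j hj => by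
    rw [Bool.eq_not]; exact (hcon j hj).symm
  have halt : ∀ j, j + 1 < n → w (i + j + 1) = !w (i + j) := by
    intro j hj
    have c0 := hcon' j (by omega)
    have c1 := hcon' (j + 1) hj
    rw [← Nat.add_assoc, ← Nat.add_assoc] at c1
    rcases h0 : w (i + j) with _ | _
    · rw [h0] at c0
      have := (C.after c0).1
      rw [c1] at this
      simpa using this
    · simpa using (C.after h0).1
  obtain ⟨n, rfl⟩ : ∃ r, n = r + 2 := ⟨n - 2, by omega⟩
  have a1 := halt n (by omega)
  have d0 := hcon' 0 (by omega)
  have d1 := hcon' 1 (by omega)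
  have b1 := halt 0 (by omega)
  simp only [Nat.add_zero, ← Nat.add_assoc] at *
  rcases hx : w (i + n + 1) with _ | _ <;> rcases hy : w (i + n + 2) with _ | _
  · have z0 : w (i + n) = true := by simp_all
    have := C.after z0
    clear hcon' halt
    simp_all
  · rcases Nat.eq_zero_or_pos n with rfl | hn
    · simp_all
    · obtain ⟨n, rfl⟩ : ∃ r, n = r + 1 := ⟨n - 1, by omega⟩
      have a2 := halt n (by omega)
      have d2 := hcon' 2 (by omega)
      have b2 := halt 1 (by omega)
      have := h10101 (i + n + 1)
      simp only [← Nat.add_assoc] at *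
      simp_all
  · rcases Nat.eq_zero_or_pos n with rfl | hn
    · simp_all
    · obtain ⟨n, rfl⟩ : ∃ r, n = r + 1 := ⟨n - 1, by omega⟩
      have a2 := halt n (by omega)
      have d2 := hcon' 2 (by omega)
      have b2 := halt 1 (by omega)
      have := h10101 (i + n)
      simp only [← Nat.add_assoc] at *
      simp_all
  · have := (C.after hx).1
    simp_all

theorem theorem6 :
    (∀ w : ℤ → Bool, GoodFactors (biFactors w) →
      ((2 + Real.goldenRatio : ℝ) : EReal) ≤ criticalExponent (biFactors w)) ∧
    (∀ w : ℕ → Bool, GoodFactors (rightFactors w) →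
      ((2 + Real.goldenRatio : ℝ) : EReal) ≤ criticalExponent (rightFactors w)) ∧
    repetitionThreshold {w : ℕ → Bool | GoodFactors (rightFactors w)} =
      ((2 + Real.goldenRatio : ℝ) : EReal) := by
  have hright : ∀ w : ℕ → Bool, GoodFactors (rightFactors w) →
      ((2 + Real.goldenRatio : ℝ) : EReal) ≤ criticalExponent (rightFactors w) := fun w hw =>
    le_criticalExponent_of_noLongAntisquare ((goodFactors_iff w).1 hw)
  refine ⟨fun w hw => ?_, hright, le_antisymm ?_ (le_iInf₂ hright)⟩
  · have hsub : rightFactors (fun k : ℕ => w k) ⊆ biFactors w := by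
      rintro u ⟨i, n, rfl⟩
      exact ⟨i, n, by simp⟩
    refine (hright (fun k : ℕ => w k) fun u hu => hw u (hsub hu)).trans ?_
    exact biSup_mono fun u hu => ⟨hsub hu.1, hu.2⟩
  · obtain ⟨s, P, Hs⟩ := exists_fixedPoint
    obtain ⟨w, Q, Hw⟩ := exists_isImage codeMorphism codeMorphism_length_pos s
    exact (iInf₂_le w ((goodFactors_iff w).2 (noLongAntisquare_code Hs Hw))).trans
      (criticalExponent_code_le Hs Hw)
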